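/- Let $f(x)=x^8+ax^6+bx^4+ax^2+1\in\mathbb{Q}[x]$ with $a\neq 0$ be irreducible over $\mathbb{Q}$, and suppose that $(b+2)^2-4a^2\in\mathbb{Q}^2$, where $\mathbb{Q}^2=\{k^2 : k\in\mathbb{Q}\}$. Regard the Galois group $\mathrm{Gal}(f)$ of $f$ over $\mathbb{Q}$ as a permutation group on the eight roots of $f$, that is, as a transitive subgroup of $S_8$ determined up to conjugacy. Here 8T2, 8T3 and 8T4 denote the conjugacy classes in $S_8$ of the regular subgroups isomorphic to $C_4\times C_2$, $C_2\times C_2\times C_2$ and the dihedral group $D_4$ of order eight, respectively, and 8T9 denotes the conjugacy class in $S_8$ of the transitive subgroups of order $16$ isomorphic to $D_4\times C_2$. Then: 1. If $b+2+2a\in\mathbb{Q}^2$, then $\mathrm{Gal}(f)$ is 8T3. 2. If $b+2+2a\notin\mathbb{Q}^2$, and $$\frac{b-6+\sqrt{(b+2)^2-4a^2}}{2}\in\mathbb{Q}^2\quad\text{or}\quad\frac{b-6-\sqrt{(b+2)^2-4a^2}}{2}\in\mathbb{Q}^2,$$ then $\mathrm{Gal}(f)$ is 8T4. 3. If $b+2+2a\notin\mathbb{Q}^2$,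 neither of the two numbers displayed in (2) lies in $\mathbb{Q}^2$, and $(a^2-4b+8)(b+2+2a)\in\mathbb{Q}^2$, then $\mathrm{Gal}(f)$ is 8T2. 4. If $b+2+2a\notin\mathbb{Q}^2$, neither of the two numbers displayed in (2) lies in $\mathbb{Q}^2$, and $(a^2-4b+8)(b+2+2a)\notin\mathbb{Q}^2$, then $\mathrm{Gal}(f)$ is 8T9. -/

import Mathlib

open Polynomial

/-- The Galois group of `f ∈ ℚ[x]`, as a permutation group on the roots of `f` in its splitting
field, is carried to the subgroup `T` of `Sₙ` by some labelling `e` of the roots by `n` letters.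
As `e` is arbitrary, this depends only on the conjugacy class of `T` in `Sₙ`, and it says that
`Gal(f)` belongs to that class. -/
def HasGaloisType {n : ℕ} (f : ℚ[X]) (T : Subgroup (Equiv.Perm (Fin n))) : Prop :=
  haveI : Fact ((f.map (algebraMap ℚ f.SplittingField)).Splits) := ⟨SplittingField.splits f⟩
  ∃ e : f.rootSet f.SplittingField ≃ Fin n,
    (Gal.galActionHom f f.SplittingField).range.map e.permCongrHom.toMonoidHom = T

/-- A representative of the class 8T2 (regular, isomorphic to `C₄ × C₂`). The eight letters are
`0, …, 7` here and below, in place of the `1, …, 8` of the tables of transitive groups. -/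
def T8_2 : Subgroup (Equiv.Perm (Fin 8)) :=
  Subgroup.closure {c[0, 1, 2, 7] * c[3, 4, 5, 6], c[0, 4] * c[1, 5] * c[2, 6] * c[3, 7]}

/-- A representative of the class 8T3 (regular, elementary abelian of order 8). -/
def T8_3 : Subgroup (Equiv.Perm (Fin 8)) :=
  Subgroup.closure {c[0, 7] * c[1, 2] * c[3, 4] * c[5, 6], c[0, 2] * c[1, 7] * c[3, 5] * c[4, 6],
    c[0, 4] * c[1, 5] * c[2, 6] * c[3, 7]}

/-- A representative of the class 8T4 (regular, dihedral of order 8). -/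
def T8_4 : Subgroup (Equiv.Perm (Fin 8)) :=
  Subgroup.closure {c[0, 1, 2, 7] * c[3, 4, 5, 6], c[0, 5] * c[1, 4] * c[2, 3] * c[6, 7]}

/-- A representative of the class 8T9 (transitive of order 16, isomorphic to the product of the
dihedral group of order 8 with `C₂`). -/
def T8_9 : Subgroup (Equiv.Perm (Fin 8)) :=
  Subgroup.closure {c[0, 7] * c[1, 2] * c[3, 4] * c[5, 6], c[0, 2] * c[1, 7] * c[3, 5] * c[4, 6],
    c[0, 4] * c[1, 5] * c[2, 6] * c[3, 7], c[3, 4] * c[5, 6]}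

/-! The octic splits into two quartics x⁴ - z x² + 1, so its roots are ±x₀^{±1}, ±x₁^{±1}. An
automorphism permutes the two quartics. Since (x₀² - x₀⁻²)(x₁² - x₁⁻²) = r is rational and nonzero,
it inverts both base roots or neither, up to signs. This leaves sixteen symmetries (w, e, s₀, s₁).

With u = x + x⁻¹ and v = x - x⁻¹, the elements v₀v₁, z₀ - z₁ and u₀v₁ + u₁v₀ are square roots of
b+2+2a, a²-4b+8 and 2(b-6+r). A symmetry multiplies them by s₀s₁, (-1)^w and s₀s₁e. When v₀v₁, u₀v₁
+ u₁v₀ or v₀v₁(z₀ - z₁) is rational, the corresponding character is trivial on the Galois group. Its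
kernel has order 8, and irreducibility makes the group transitive on eight roots, so the group is
that whole kernel (`exists_acts_of_sign_mul`).

If none of the conditions holds, all sixteen symmetries occur. Otherwise the stabilizer of x₀ is
trivial, s₀s₁ is a function of (w, e), and a Kummer-type argument (`fixed_of_sign_dependent`) makes
one of the excluded radicands a square (`exists_acts_stabilizer`). -/

/-- The roots `±x₀^{±1}, ±x₁^{±1}` are indexed by the base point, the exponent and the sign. -/
abbrev RootIndex := Bool × ℤˣ × ℤˣ

/-- A symmetry `x₀ ↦ s₀ x_w^e`, `x₁ ↦ s₁ x_{1-w}^e`, stored as `(w, e, s₀, s₁)`. -/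
abbrev RootSymm := Bool × ℤˣ × ℤˣ × ℤˣ

/-- The sign which a symmetry attaches to a base point. -/
def RootSymm.sign (m : RootSymm) (i : Bool) : ℤˣ := if i then m.2.2.2 else m.2.2.1

/-- The action of a symmetry on the indices of the roots. -/
def RootSymm.act (m : RootSymm) (p : RootIndex) : RootIndex :=
  (xor p.1 m.1, m.2.1 * p.2.1, p.2.2 * m.sign p.1)

/-- A labelling of the roots adapted to the three regular groups. -/
def regularLabel : Fin 8 → RootIndex :=
  ![(false, 1, 1), (true, -1, 1), (false, 1, -1), (true, 1, 1), (false, -1, -1), (true, 1, -1),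
    (false, -1, 1), (true, -1, -1)]

/-- A labelling of the roots adapted to `T8_9`. -/
def genericLabel : Fin 8 → RootIndex :=
  ![(false, 1, 1), (false, -1, 1), (false, -1, -1), (true, 1, 1), (true, 1, -1), (true, -1, -1),
    (true, -1, 1), (false, 1, -1)]

/-! ### Index symmetries as words in the generators. -/

theorem regularLabel_bijective : Function.Bijective regularLabel := by
  constructor
  · unfold Function.Injective; decide
  · unfold Function.Surjective; decide

theorem genericLabel_bijective : Function.Bijective genericLabel := by
  constructor
  · unfold Function.Injective; decide
  · unfold Function.Surjective; decide

theorem exists_mem_T8_9 : ∀ m : RootSymm, ∃ π ∈ T8_9,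
    ∀ j, m.act (genericLabel j) = genericLabel (π j) := by
  -- Every element is a product of generator powers in a fixed order, so membership in the closure
  -- becomes a finite search.
  have h : ∀ m : RootSymm, ∃ i j k l : Fin 2, ∀ t, m.act (genericLabel t) = genericLabel
      (((c[0, 7] * c[1, 2] * c[3, 4] * c[5, 6]) ^ (i : ℕ) *
        (c[0, 2] * c[1, 7] * c[3, 5] * c[4, 6]) ^ (j : ℕ) *
        (c[0, 4] * c[1, 5] * c[2, 6] * c[3, 7]) ^ (k : ℕ) *
        (c[3, 4] * c[5, 6]) ^ (l : ℕ) : Equiv.Perm (Fin 8)) t) := by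
    decide +kernel
  intro m
  obtain ⟨i, j, k, l, h⟩ := h m
  refine ⟨_, ?_, h⟩
  refine mul_mem (mul_mem (mul_mem ?_ ?_) ?_) ?_ <;>
    exact pow_mem (Subgroup.subset_closure (by simp)) _

theorem exists_mem_T8_3 : ∀ m : RootSymm, m.sign false * m.sign true = 1 → ∃ π ∈ T8_3,
    ∀ j, m.act (regularLabel j) = regularLabel (π j) := by
  have h : ∀ m : RootSymm, m.sign false * m.sign true = 1 → ∃ i j k : Fin 2,
      ∀ t, m.act (regularLabel t) = regularLabel
      (((c[0, 7] * c[1, 2] * c[3, 4] * c[5, 6]) ^ (i : ℕ) *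
        (c[0, 2] * c[1, 7] * c[3, 5] * c[4, 6]) ^ (j : ℕ) *
        (c[0, 4] * c[1, 5] * c[2, 6] * c[3, 7]) ^ (k : ℕ) : Equiv.Perm (Fin 8)) t) := by
    decide +kernel
  intro m hm
  obtain ⟨i, j, k, h⟩ := h m hm
  refine ⟨_, ?_, h⟩
  refine mul_mem (mul_mem ?_ ?_) ?_ <;> exact pow_mem (Subgroup.subset_closure (by simp)) _

theorem exists_mem_T8_2 : ∀ m : RootSymm, m.sign false * m.sign true = (if m.1 then -1 else 1) →
    ∃ π ∈ T8_2, ∀ j, m.act (regularLabel j) = regularLabel (π j) := by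
  have h : ∀ m : RootSymm, m.sign false * m.sign true = (if m.1 then -1 else 1) →
      ∃ (i : Fin 4) (j : Fin 2), ∀ t, m.act (regularLabel t) = regularLabel
      (((c[0, 1, 2, 7] * c[3, 4, 5, 6]) ^ (i : ℕ) *
        (c[0, 4] * c[1, 5] * c[2, 6] * c[3, 7]) ^ (j : ℕ) : Equiv.Perm (Fin 8)) t) := by
    decide +kernel
  intro m hm
  obtain ⟨i, j, h⟩ := h m hm
  refine ⟨_, ?_, h⟩
  refine mul_mem ?_ ?_ <;> exact pow_mem (Subgroup.subset_closure (by simp)) _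

theorem exists_mem_T8_4 : ∀ m : RootSymm, m.sign false * m.sign true = m.2.1 →
    ∃ π ∈ T8_4, ∀ j, m.act (regularLabel j) = regularLabel (π j) := by
  have h : ∀ m : RootSymm, m.sign false * m.sign true = m.2.1 →
      ∃ (i : Fin 4) (j : Fin 2), ∀ t, m.act (regularLabel t) = regularLabel
      (((c[0, 1, 2, 7] * c[3, 4, 5, 6]) ^ (i : ℕ) *
        (c[0, 5] * c[1, 4] * c[2, 3] * c[6, 7]) ^ (j : ℕ) : Equiv.Perm (Fin 8)) t) := by
    decide +kernel
  intro m hm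
  obtain ⟨i, j, h⟩ := h m hm
  refine ⟨_, ?_, h⟩
  refine mul_mem ?_ ?_ <;> exact pow_mem (Subgroup.subset_closure (by simp)) _

/-! ### Galois types read from labelled roots. -/

theorem isSplittingField_splittingField_rat (f : ℚ[X]) : IsSplittingField ℚ f.SplittingField f :=
  IsSplittingField.splittingField f

theorem isGalois_splittingField_rat {f : ℚ[X]} (hf : f.Separable) :
    IsGalois ℚ f.SplittingField :=
  haveI := isSplittingField_splittingField_rat f
  IsGalois.of_separable_splitting_field hf

/-- A set of permutations generating the Galois type is recognised on a labelling of the roots: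
automorphisms act through the generated group, and every generator comes from an automorphism. -/
theorem hasGaloisType_closure {n : ℕ} {f : ℚ[X]} (S : Set (Equiv.Perm (Fin n)))
    (ρ : Fin n → f.SplittingField) (hinj : Function.Injective ρ)
    (hrange : Set.range ρ = f.rootSet f.SplittingField)
    (hmem : ∀ φ : f.SplittingField ≃ₐ[ℚ] f.SplittingField,
      ∃ π ∈ Subgroup.closure S, ∀ j, φ (ρ j) = ρ (π j))
    (hgen : ∀ π ∈ S, ∃ φ : f.SplittingField ≃ₐ[ℚ] f.SplittingField, ∀ j, φ (ρ j) = ρ (π j)) :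
    HasGaloisType f (Subgroup.closure S) := by
  have : Fact ((f.map (algebraMap ℚ f.SplittingField)).Splits) := ⟨SplittingField.splits f⟩
  have := isSplittingField_splittingField_rat f
  have : Normal ℚ f.SplittingField := Normal.of_isSplittingField f
  let e : f.rootSet f.SplittingField ≃ Fin n :=
    ((Equiv.ofInjective ρ hinj).trans (Equiv.setCongr hrange)).symm
  have he : ∀ j, ((e.symm j : f.rootSet f.SplittingField) : f.SplittingField) = ρ j := fun j => rfl
  have key : ∀ (φ : f.SplittingField ≃ₐ[ℚ] f.SplittingField) (π : Equiv.Perm (Fin n)),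
      (∀ j, φ (ρ j) = ρ (π j)) →
      e.permCongrHom (Gal.galActionHom f f.SplittingField (Gal.restrict f _ φ)) = π := by
    intro φ π h
    ext1 j
    have : (Gal.galActionHom f f.SplittingField (Gal.restrict f _ φ)) (e.symm j) = e.symm (π j) := by
      apply Subtype.ext
      rw [Gal.galActionHom_restrict, he, he, h]
    simp [Equiv.permCongrHom, this]
  refine ⟨e, le_antisymm ?_ ?_⟩
  · rintro _ ⟨_, ⟨σ, rfl⟩, rfl⟩
    obtain ⟨φ, rfl⟩ := Gal.restrict_surjective f f.SplittingField σ
    obtain ⟨π, hπ, h⟩ := hmem φ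
    have := key φ π h
    simpa [this] using hπ
  · rw [Subgroup.closure_le]
    intro π hπ
    obtain ⟨φ, h⟩ := hgen π hπ
    exact ⟨_, ⟨_, rfl⟩, key φ π h⟩

/-! ### The octic and its eight roots. -/

/-- The even reciprocal octic attached to `a` and `b`. -/
noncomputable def evenReciprocalOctic (a b : ℚ) : ℚ[X] :=
  X ^ 8 + C a * X ^ 6 + C b * X ^ 4 + C a * X ^ 2 + 1

/-- Two roots `x false`, `x true` of the octic, from different factors `x⁴ - z x² + 1`, with the
sign of the square root `r` of `(b + 2)² - 4 a²` matched. -/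
structure BaseRoots (a b r : ℚ) (L : Type*) [Field L] [Algebra ℚ L] where
  x : Bool → L
  ne_zero : ∀ i, x i ≠ 0
  sum_eq : (x false ^ 2 + (x false)⁻¹ ^ 2) + (x true ^ 2 + (x true)⁻¹ ^ 2) = -algebraMap ℚ L a
  prod_eq : (x false ^ 2 + (x false)⁻¹ ^ 2) * (x true ^ 2 + (x true)⁻¹ ^ 2) = algebraMap ℚ L (b - 2)
  sq_sub_eq : (x false ^ 2 - (x false)⁻¹ ^ 2) * (x true ^ 2 - (x true)⁻¹ ^ 2) = algebraMap ℚ L r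

theorem aeval_evenReciprocalOctic {L : Type*} [Field L] [Algebra ℚ L] (a b : ℚ) (y : L) :
    aeval y (evenReciprocalOctic a b) =
      y ^ 8 + algebraMap ℚ L a * y ^ 6 + algebraMap ℚ L b * y ^ 4 + algebraMap ℚ L a * y ^ 2 + 1 := by
  simp [evenReciprocalOctic]

theorem natDegree_evenReciprocalOctic (a b : ℚ) : (evenReciprocalOctic a b).natDegree = 8 := by
  unfold evenReciprocalOctic; compute_degree!

theorem monic_evenReciprocalOctic (a b : ℚ) : (evenReciprocalOctic a b).Monic := by
  unfold evenReciprocalOctic; monicity!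

/-- Dividing by x⁴ shows that z = x² + x⁻² is a root of z² + az + b - 2. The second base root comes
from the other value -a - z. The identity (z₁² - 4)(z₂² - 4) = (b+2)² - 4a² gives the product of the
x² - x⁻² up to sign. -/
theorem exists_baseRoots {L : Type*} [Field L] [Algebra ℚ L] {a b r : ℚ}
    (hs : ((evenReciprocalOctic a b).map (algebraMap ℚ L)).Splits)
    (hr : (b + 2) ^ 2 - 4 * a ^ 2 = r ^ 2) : Nonempty (BaseRoots a b r L) := by
  have hm := monic_evenReciprocalOctic a b
  obtain ⟨x₁, h₁⟩ := hs.exists_eval_eq_zero (by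
    rw [degree_map, degree_eq_natDegree hm.ne_zero, natDegree_evenReciprocalOctic]; decide)
  rw [eval_map_algebraMap, aeval_evenReciprocalOctic] at h₁
  have hx₁ : x₁ ≠ 0 := by rintro rfl; simp at h₁
  set A := algebraMap ℚ L a with hA
  set B := algebraMap ℚ L b with hB
  obtain ⟨z₁, hz₁⟩ : ∃ z, z = x₁ ^ 2 + x₁⁻¹ ^ 2 := ⟨_, rfl⟩
  have hz : z₁ ^ 2 + A * z₁ + B - 2 = 0 := by
    rw [hz₁]; field_simp; linear_combination h₁
  have hfac : (evenReciprocalOctic a b).map (algebraMap ℚ L) =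
      (X ^ 4 - C z₁ * X ^ 2 + 1) * (X ^ 4 - C (-A - z₁) * X ^ 2 + 1) := by
    have hBz : B = 2 - A * z₁ - z₁ ^ 2 := by linear_combination hz
    simp only [evenReciprocalOctic, Polynomial.map_add, Polynomial.map_mul, Polynomial.map_pow,
      map_X, map_C, Polynomial.map_one, ← hA, ← hB]
    rw [hBz]
    simp only [map_sub, map_neg, map_mul, map_pow, map_ofNat]
    ring
  have hdeg : (X ^ 4 - C (-A - z₁) * X ^ 2 + 1 : L[X]).natDegree = 4 := by compute_degree!
  obtain ⟨x₂, h₂⟩ := (hs.of_dvd (hm.map _).ne_zero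
    (Dvd.intro_left _ hfac.symm)).exists_eval_eq_zero (by
      intro h
      rw [natDegree_eq_of_degree_eq_some (n := 0) h] at hdeg
      exact absurd hdeg (by decide))
  simp only [eval_add, eval_sub, eval_mul, eval_pow, eval_X, eval_C, eval_one] at h₂
  have hx₂ : x₂ ≠ 0 := by rintro rfl; simp at h₂
  have hz₂ : x₂ ^ 2 + x₂⁻¹ ^ 2 = -A - z₁ := by
    field_simp; linear_combination h₂
  have e₁ : (x₁ ^ 2 - x₁⁻¹ ^ 2) ^ 2 = z₁ ^ 2 - 4 := by rw [hz₁]; field_simp; ring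
  have e₂ : (x₂ ^ 2 - x₂⁻¹ ^ 2) ^ 2 = (-A - z₁) ^ 2 - 4 := by rw [← hz₂]; field_simp; ring
  have hR : (B + 2) ^ 2 - 4 * A ^ 2 = algebraMap ℚ L r ^ 2 := by
    simpa only [map_sub, map_add, map_mul, map_pow, map_ofNat] using congrArg (algebraMap ℚ L) hr
  have hsq : ((x₁ ^ 2 - x₁⁻¹ ^ 2) * (x₂ ^ 2 - x₂⁻¹ ^ 2)) ^ 2 = algebraMap ℚ L r ^ 2 := by
    rw [mul_pow, e₁, e₂, ← hR]
    linear_combination (z₁ ^ 2 + A * z₁ - 6 - B) * hz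
  have hprod : z₁ * (-A - z₁) = algebraMap ℚ L (b - 2) := by
    simp only [map_sub, map_ofNat]; linear_combination -hz
  rcases sq_eq_sq_iff_eq_or_eq_neg.mp hsq with h | h
  · refine ⟨⟨fun i => if i then x₂ else x₁, ?_, ?_, ?_, ?_⟩⟩
    · intro i; cases i <;> simpa
    · simp only [Bool.false_eq_true, if_false, if_true, ← hz₁, hz₂]
      ring
    · simp only [Bool.false_eq_true, if_false, if_true, ← hz₁, hz₂, hprod]
    · simpa using h
  -- Inverting x₂ keeps z₂ and negates x₂² - x₂⁻², which corrects the sign of r.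
  · refine ⟨⟨fun i => if i then x₂⁻¹ else x₁, ?_, ?_, ?_, ?_⟩⟩
    · intro i; cases i <;> simpa
    · simp only [Bool.false_eq_true, if_false, if_true, inv_inv, ← hz₁, add_comm (x₂⁻¹ ^ 2), hz₂]
      ring
    · simp only [Bool.false_eq_true, if_false, if_true, inv_inv, ← hz₁, add_comm (x₂⁻¹ ^ 2), hz₂,
        hprod]
    · simp only [Bool.false_eq_true, if_false, if_true, inv_inv]
      linear_combination -h

namespace BaseRoots

variable {a b r : ℚ} {L : Type*} [Field L] [Algebra ℚ L] (d : BaseRoots a b r L)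

/-- The root with a given index. -/
def root (p : RootIndex) : L := ((p.2.2 : ℤ) : L) * d.x p.1 ^ ((p.2.1 : ℤˣ) : ℤ)

/-- The parameter `z` of the factor `x⁴ - z x² + 1`. -/
def z (i : Bool) : L := d.x i ^ 2 + (d.x i)⁻¹ ^ 2

/-- The sum `u = x + x⁻¹`. -/
def u (i : Bool) : L := d.x i + (d.x i)⁻¹

/-- The difference `v = x - x⁻¹`. -/
def v (i : Bool) : L := d.x i - (d.x i)⁻¹

theorem u_sq (i : Bool) : d.u i ^ 2 = d.z i + 2 := by
  have := d.ne_zero i; simp only [u, z]; field_simp; ring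

theorem v_sq (i : Bool) : d.v i ^ 2 = d.z i - 2 := by
  have := d.ne_zero i; simp only [v, z]; field_simp; ring

theorem z_add : d.z false + d.z true = -algebraMap ℚ L a := d.sum_eq

theorem z_mul : d.z false * d.z true = algebraMap ℚ L (b - 2) := d.prod_eq

theorem uv_mul : d.u false * d.v false * (d.u true * d.v true) = algebraMap ℚ L r := by
  rw [← d.sq_sub_eq]; simp only [u, v]; ring

theorem exists_root_eq_of_factor {y : L} {i : Bool} (hi : y ^ 4 - d.z i * y ^ 2 + 1 = 0) :
    ∃ q, d.root (i, q) = y := by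
  have hfac : y ^ 4 - d.z i * y ^ 2 + 1 =
      (y - d.x i) * (y + d.x i) * ((y - (d.x i)⁻¹) * (y + (d.x i)⁻¹)) := by
    have := d.ne_zero i
    simp only [z]; field_simp; ring
  rw [hfac, mul_eq_zero, mul_eq_zero, mul_eq_zero] at hi
  rcases hi with (h | h) | (h | h)
  · exact ⟨(1, 1), by simp [root]; linear_combination -h⟩
  · exact ⟨(1, -1), by simp [root]; linear_combination -h⟩
  · exact ⟨(-1, 1), by simp [root]; linear_combination -h⟩
  · exact ⟨(-1, -1), by simp [root]; linear_combination -h⟩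

theorem exists_root_eq {y : L} (hy : aeval y (evenReciprocalOctic a b) = 0) :
    ∃ p, d.root p = y := by
  rw [aeval_evenReciprocalOctic] at hy
  have h : (y ^ 4 - d.z false * y ^ 2 + 1) * (y ^ 4 - d.z true * y ^ 2 + 1) = 0 := by
    have hp := d.z_mul
    simp only [map_sub, map_ofNat] at hp
    linear_combination hy - (y ^ 6 + y ^ 2) * d.z_add + y ^ 4 * hp
  rcases mul_eq_zero.mp h with h | h
  exacts [(d.exists_root_eq_of_factor h).imp' _ fun _ => id,
    (d.exists_root_eq_of_factor h).imp' _ fun _ => id]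

theorem aeval_root (p : RootIndex) : aeval (d.root p) (evenReciprocalOctic a b) = 0 := by
  rw [aeval_evenReciprocalOctic]
  have hA : algebraMap ℚ L a = -(d.z false + d.z true) := by rw [d.z_add, neg_neg]
  have hB : algebraMap ℚ L b = d.z false * d.z true + 2 := by rw [d.z_mul, map_sub, map_ofNat]; ring
  rw [hA, hB]
  have hfac : ∀ (y : L) (i : Bool), y ^ 4 - d.z i * y ^ 2 + 1 = 0 →
      y ^ 8 + -(d.z false + d.z true) * y ^ 6 + (d.z false * d.z true + 2) * y ^ 4 +
        -(d.z false + d.z true) * y ^ 2 + 1 = 0 := by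
    intro y i hi
    cases i
    · linear_combination (y ^ 4 - d.z true * y ^ 2 + 1) * hi
    · linear_combination (y ^ 4 - d.z false * y ^ 2 + 1) * hi
  obtain ⟨i, e, s⟩ := p
  apply hfac _ i
  have := d.ne_zero i
  rcases Int.units_eq_one_or e with rfl | rfl <;> rcases Int.units_eq_one_or s with rfl | rfl <;>
    simp [root, z] <;> field_simp <;> ring

theorem range_root : Set.range d.root = (evenReciprocalOctic a b).rootSet L := by
  ext y
  rw [mem_rootSet_of_ne (monic_evenReciprocalOctic a b).ne_zero]
  exact ⟨fun ⟨p, hp⟩ => hp ▸ d.aeval_root p, d.exists_root_eq⟩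

/-- Eight indices map onto the roots of a separable octic, which number eight. -/
theorem root_injective (hirr : Irreducible (evenReciprocalOctic a b))
    (hs : ((evenReciprocalOctic a b).map (algebraMap ℚ L)).Splits) :
    Function.Injective d.root := by
  have hc := card_rootSet_eq_natDegree hirr.separable hs
  rw [natDegree_evenReciprocalOctic, ← Nat.card_eq_fintype_card, ← d.range_root] at hc
  have hsurj : Function.Surjective (Set.rangeFactorization d.root) := Set.rangeFactorization_surjective
  have hbij := (Nat.bijective_iff_surjective_and_card _).mpr ⟨hsurj, by
    rw [hc, Nat.card_eq_fintype_card]; rfl⟩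
  exact (Set.rangeFactorization_injective).mp hbij.injective

end BaseRoots

/-- Among three elements which a group of automorphisms moves only up to sign, the first two
moved independently, if fixing the first two forces fixing the third, then the third becomes
invariant after multiplication by some of the first two. -/
theorem fixed_of_sign_dependent {K L : Type*} [Field K] [Field L] [Algebra K L] {Z E Q : L}
    (hZ : ∀ g : L ≃ₐ[K] L, g Z = Z ∨ g Z = -Z) (hE : ∀ g : L ≃ₐ[K] L, g E = E ∨ g E = -E)
    (hQ : ∀ g : L ≃ₐ[K] L, g Q = Q ∨ g Q = -Q) {σ τ : L ≃ₐ[K] L} (hσZ : σ Z = Z) (hσE : σ E = -E)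
    (hτZ : τ Z = -Z) (hτE : τ E = E)
    (hker : ∀ g : L ≃ₐ[K] L, g Z = Z → g E = E → g Q = Q) :
    (∀ g : L ≃ₐ[K] L, g Q = Q) ∨ (∀ g : L ≃ₐ[K] L, g (Q * Z) = Q * Z) ∨
      (∀ g : L ≃ₐ[K] L, g (Q * E) = Q * E) ∨ (∀ g : L ≃ₐ[K] L, g (Q * Z * E) = Q * Z * E) := by
  -- One of g, gσ, gτ, gστ fixes both Z and E, so the signs of g on Z and E determine g on Q.
  have h (g : L ≃ₐ[K] L) := hker g
  have hs (g : L ≃ₐ[K] L) := hker (g * σ)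
  have ht (g : L ≃ₐ[K] L) := hker (g * τ)
  have hst (g : L ≃ₐ[K] L) := hker (g * σ * τ)
  simp only [AlgEquiv.mul_apply, hσZ, hσE, hτZ, hτE, map_neg] at hs ht hst
  have cover : ∀ g : L ≃ₐ[K] L, (g Z = Z ∧ g E = E ∧ g Q = Q) ∨
      (g Z = Z ∧ g E = -E ∧ g (σ Q) = Q) ∨ (g Z = -Z ∧ g E = E ∧ g (τ Q) = Q) ∨
      (g Z = -Z ∧ g E = -E ∧ g (σ (τ Q)) = Q) := by
    intro g
    rcases hZ g with z | z <;> rcases hE g with e | e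
    · exact .inl ⟨z, e, h g z e⟩
    · exact .inr (.inl ⟨z, e, hs g z (by rw [e, neg_neg])⟩)
    · exact .inr (.inr (.inl ⟨z, e, ht g (by rw [z, neg_neg]) e⟩))
    · exact .inr (.inr (.inr ⟨z, e, hst g (by rw [z, neg_neg]) (by rw [e, neg_neg])⟩))
  -- The sign of τ on Q decides whether a factor Z is needed, and the sign of σ whether E is.
  rcases hQ σ with s | s <;> rcases hQ τ with t | t <;>
    simp only [s, t, map_neg, neg_neg] at cover
  · refine .inl fun g => ?_
    rcases cover g with ⟨z, e, q⟩ | ⟨z, e, q⟩ | ⟨z, e, q⟩ | ⟨z, e, q⟩ <;> exact q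
  · refine .inr (.inl fun g => ?_)
    rcases cover g with ⟨z, e, q⟩ | ⟨z, e, q⟩ | ⟨z, e, q⟩ | ⟨z, e, q⟩ <;>
      first | (rw [map_mul, q, z]) | (rw [neg_eq_iff_eq_neg] at q; rw [map_mul, q, z, neg_mul_neg])
  · refine .inr (.inr (.inl fun g => ?_))
    rcases cover g with ⟨z, e, q⟩ | ⟨z, e, q⟩ | ⟨z, e, q⟩ | ⟨z, e, q⟩ <;>
      first | (rw [map_mul, q, e]) | (rw [neg_eq_iff_eq_neg] at q; rw [map_mul, q, e, neg_mul_neg])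
  · refine .inr (.inr (.inr fun g => ?_))
    rcases cover g with ⟨z, e, q⟩ | ⟨z, e, q⟩ | ⟨z, e, q⟩ | ⟨z, e, q⟩ <;>
      (try rw [neg_eq_iff_eq_neg] at q) <;> rw [map_mul, map_mul, q, z, e] <;> ring

/-! ### Automorphisms as symmetries of the roots. -/

namespace BaseRoots

variable {a b r : ℚ} {L : Type*} [Field L] [Algebra ℚ L] (d : BaseRoots a b r L)

/-- The automorphism `φ` permutes the roots by the symmetry `m`. -/
def Acts (φ : L ≃ₐ[ℚ] L) (m : RootSymm) : Prop := ∀ p, φ (d.root p) = d.root (m.act p)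

variable {d}

theorem z_ne (hinj : Function.Injective d.root) : d.z false ≠ d.z true := by
  intro h
  obtain ⟨q, hq⟩ := d.exists_root_eq_of_factor (y := d.x true) (i := false) (by
    have := d.ne_zero true
    rw [h, z]; field_simp; ring)
  have := @hinj (false, q) (true, 1, 1) (by rw [hq]; simp [root])
  simp at this

theorem u_ne (hinj : Function.Injective d.root) (i : Bool) : d.u i ≠ 0 := by
  intro h
  have := @hinj (i, 1, 1) (i, -1, -1) (by
    simp only [u] at h
    simp [root]; linear_combination h)
  simp at this

theorem v_ne (hinj : Function.Injective d.root) (i : Bool) : d.v i ≠ 0 := by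
  intro h
  have := @hinj (i, 1, 1) (i, -1, 1) (by
    simp only [v] at h
    simp [root]; linear_combination h)
  simp at this

theorem map_z_of_map_x {φ : L ≃ₐ[ℚ] L} {k i : Bool} {e s : ℤˣ} (h : φ (d.x k) = d.root (i, e, s)) :
    φ (d.z k) = d.z i := by
  simp only [z, map_add, map_pow, map_inv₀, h]
  rcases Int.units_eq_one_or e with rfl | rfl <;> rcases Int.units_eq_one_or s with rfl | rfl <;>
    simp [root, add_comm, inv_neg]

theorem map_u_of_map_x {φ : L ≃ₐ[ℚ] L} {k i : Bool} {e s : ℤˣ} (h : φ (d.x k) = d.root (i, e, s)) :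
    φ (d.u k) = ((s : ℤ) : L) * d.u i := by
  simp only [u, map_add, map_inv₀, h]
  rcases Int.units_eq_one_or e with rfl | rfl <;> rcases Int.units_eq_one_or s with rfl | rfl <;>
    simp [root, add_comm, inv_neg]

theorem map_v_of_map_x {φ : L ≃ₐ[ℚ] L} {k i : Bool} {e s : ℤˣ} (h : φ (d.x k) = d.root (i, e, s)) :
    φ (d.v k) = ((s : ℤ) : L) * ((e : ℤ) : L) * d.v i := by
  simp only [v, map_sub, map_inv₀, h]
  rcases Int.units_eq_one_or e with rfl | rfl <;> rcases Int.units_eq_one_or s with rfl | rfl <;>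
    simp [root, inv_neg] <;> ring

theorem acts_of_map_x {φ : L ≃ₐ[ℚ] L} {i : Bool} {e s₀ s₁ : ℤˣ}
    (h₀ : φ (d.x false) = d.root (i, e, s₀)) (h₁ : φ (d.x true) = d.root (!i, e, s₁)) :
    d.Acts φ (i, e, s₀, s₁) := by
  rintro ⟨k, e', s'⟩
  have key : ∀ (j : Bool) (s : ℤˣ), φ (d.x k) = d.root (j, e, s) →
      φ (d.root (k, e', s')) = d.root (j, e * e', s' * s) := by
    intro j s h
    have : φ (d.root (k, e', s')) = ((s' : ℤ) : L) * φ (d.x k) ^ (e' : ℤ) := by simp [root]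
    rw [this, h]
    rcases Int.units_eq_one_or e' with rfl | rfl <;> rcases Int.units_eq_one_or s with rfl | rfl <;>
      simp [root, inv_neg]
  cases k
  · simpa [RootSymm.act, RootSymm.sign] using key _ _ h₀
  · simpa [RootSymm.act, RootSymm.sign] using key _ _ h₁

theorem Acts.map_x_false {φ : L ≃ₐ[ℚ] L} {m : RootSymm} (h : d.Acts φ m) :
    φ (d.x false) = d.root (m.1, m.2.1, m.2.2.1) := by
  simpa [root, RootSymm.act, RootSymm.sign] using h (false, 1, 1)

theorem Acts.map_x_true {φ : L ≃ₐ[ℚ] L} {m : RootSymm} (h : d.Acts φ m) :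
    φ (d.x true) = d.root (!m.1, m.2.1, m.2.2.2) := by
  simpa [root, RootSymm.act, RootSymm.sign] using h (true, 1, 1)

/-- As z₀ ≠ z₁, the base roots go to different quartics. Each u v is sent to ±u v of the image
quartic, the sign being the exponent; since the product of the two is the nonzero rational r, the
exponents agree. -/
theorem exists_acts (hinj : Function.Injective d.root) (φ : L ≃ₐ[ℚ] L) : ∃ m, d.Acts φ m := by
  have hroot : ∀ k, ∃ p, d.root p = φ (d.x k) := by
    intro k
    apply d.exists_root_eq
    have := d.aeval_root (k, 1, 1)
    rw [show d.root (k, 1, 1) = d.x k by simp [root]] at this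
    exact (aeval_algHom_apply (φ : L →ₐ[ℚ] L) _ _).trans (by rw [this, map_zero])
  obtain ⟨⟨i, e, s₀⟩, h₀⟩ := hroot false
  obtain ⟨⟨j, e', s₁⟩, h₁⟩ := hroot true
  have hij : j = !i := by
    by_contra hne
    obtain rfl : j = i := by cases i <;> cases j <;> simp_all
    exact z_ne hinj (φ.injective ((map_z_of_map_x h₀.symm).trans (map_z_of_map_x h₁.symm).symm))
  subst hij
  have hprod := congrArg φ d.uv_mul
  simp only [map_mul, map_u_of_map_x h₀.symm, map_u_of_map_x h₁.symm, map_v_of_map_x h₀.symm,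
    map_v_of_map_x h₁.symm, AlgEquiv.commutes] at hprod
  rw [← d.uv_mul] at hprod
  have hn := mul_ne_zero (mul_ne_zero (u_ne hinj false) (v_ne hinj false))
    (mul_ne_zero (u_ne hinj true) (v_ne hinj true))
  have : CharZero L := algebraRat.charZero L
  obtain rfl : e' = e := by
    rcases Int.units_eq_one_or e with rfl | rfl <;> rcases Int.units_eq_one_or e' with rfl | rfl
    · rfl
    · exfalso; apply hn
      rcases Int.units_eq_one_or s₀ with rfl | rfl <;> rcases Int.units_eq_one_or s₁ with rfl | rfl <;>
        cases i <;> simp at hprod <;> linear_combination -hprod / 2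
    · exfalso; apply hn
      rcases Int.units_eq_one_or s₀ with rfl | rfl <;> rcases Int.units_eq_one_or s₁ with rfl | rfl <;>
        cases i <;> simp at hprod <;> linear_combination -hprod / 2
    · rfl
  exact ⟨_, acts_of_map_x h₀.symm h₁.symm⟩

end BaseRoots

theorem exists_algebraMap_eq_of_fixed {K L : Type*} [Field K] [Field L] [Algebra K L]
    [FiniteDimensional K L] [IsGalois K L] {y : L} (h : ∀ φ : L ≃ₐ[K] L, φ y = y) :
    ∃ q, algebraMap K L q = y :=
  IntermediateField.mem_bot.mp ((IsGalois.mem_bot_iff_fixed y).mpr h)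

theorem Int.units_cast_mul_eq_self {L : Type*} [Field L] [CharZero L] {s : ℤˣ} {y : L}
    (hy : y ≠ 0) (h : ((s : ℤ) : L) * y = y) : s = 1 := by
  rcases Int.units_eq_one_or s with rfl | rfl
  · rfl
  · refine absurd ?_ hy
    simp only [Units.val_neg, Units.val_one, Int.cast_neg, Int.cast_one] at h
    linear_combination -h / 2

/-! ### Three square roots and their sign characters. -/

namespace BaseRoots

variable {a b r : ℚ} {L : Type*} [Field L] [Algebra ℚ L] {d : BaseRoots a b r L}

variable (d) in
/-- The product `v₀ v₁`, a square root of `b + 2 + 2a`. -/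
def vProd : L := d.v false * d.v true

variable (d) in
/-- The difference `z₀ - z₁`, a square root of `a² - 4b + 8`. -/
def zDiff : L := d.z false - d.z true

variable (d) in
/-- The sum `u₀ v₁ + u₁ v₀`, a square root of `2(b - 6 + r)`. -/
def uvSum : L := d.u false * d.v true + d.u true * d.v false

theorem vProd_sq : d.vProd ^ 2 = algebraMap ℚ L (b + 2 + 2 * a) := by
  have h₁ := d.z_add
  have h₂ := d.z_mul
  simp only [map_sub, map_add, map_mul, map_ofNat] at *
  rw [vProd, mul_pow, v_sq, v_sq]
  linear_combination h₂ - 2 * h₁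

theorem zDiff_sq : d.zDiff ^ 2 = algebraMap ℚ L (a ^ 2 - 4 * b + 8) := by
  have h₁ := d.z_add
  have h₂ := d.z_mul
  simp only [map_sub, map_add, map_mul, map_ofNat, map_pow] at *
  rw [zDiff]
  linear_combination (d.z false + d.z true - algebraMap ℚ L a) * h₁ - 4 * h₂

theorem uvSum_sq : d.uvSum ^ 2 = algebraMap ℚ L (2 * (b - 6 + r)) := by
  have h₁ := d.z_add
  have h₂ := d.z_mul
  have h₃ := d.uv_mul
  simp only [map_sub, map_add, map_mul, map_ofNat] at *
  rw [uvSum]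
  linear_combination d.v true ^ 2 * d.u_sq false + (d.z false + 2) * d.v_sq true +
    d.v false ^ 2 * d.u_sq true + (d.z true + 2) * d.v_sq false + 2 * h₃ + 2 * h₂

theorem vProd_ne (hinj : Function.Injective d.root) : d.vProd ≠ 0 :=
  mul_ne_zero (v_ne hinj _) (v_ne hinj _)

theorem zDiff_ne (hinj : Function.Injective d.root) : d.zDiff ≠ 0 := sub_ne_zero.mpr (z_ne hinj)

theorem uvSum_ne (hinj : Function.Injective d.root) : d.uvSum ≠ 0 := by
  have : CharZero L := algebraRat.charZero L
  intro h
  -- Multiplying by the conjugate sum leaves a multiple of z₀ - z₁, which is nonzero.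
  have h' : d.uvSum * (d.u false * d.v true - d.u true * d.v false) = -4 * d.zDiff := by
    rw [uvSum, zDiff]
    linear_combination d.v true ^ 2 * d.u_sq false + (d.z false + 2) * d.v_sq true -
      d.v false ^ 2 * d.u_sq true - (d.z true + 2) * d.v_sq false
  rw [h, zero_mul] at h'
  exact zDiff_ne hinj (by linear_combination h' / 4)

theorem Acts.map_vProd {φ : L ≃ₐ[ℚ] L} {m : RootSymm} (h : d.Acts φ m) :
    φ d.vProd = (((m.sign false * m.sign true : ℤˣ) : ℤ) : L) * d.vProd := by
  obtain ⟨i, e, s₀, s₁⟩ := m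
  have h₀ := map_v_of_map_x h.map_x_false
  have h₁ := map_v_of_map_x h.map_x_true
  have he : ((e : ℤ) : L) * ((e : ℤ) : L) = 1 := by
    rcases Int.units_eq_one_or e with rfl | rfl <;> simp
  simp only [vProd, map_mul, h₀, h₁, RootSymm.sign]
  cases i <;> simp <;> linear_combination
    ((s₀ : ℤ) : L) * ((s₁ : ℤ) : L) * d.v false * d.v true * he

theorem Acts.map_zDiff {φ : L ≃ₐ[ℚ] L} {m : RootSymm} (h : d.Acts φ m) :
    φ d.zDiff = (((if m.1 then -1 else 1 : ℤˣ) : ℤ) : L) * d.zDiff := by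
  obtain ⟨i, e, s₀, s₁⟩ := m
  simp only [zDiff, map_sub, map_z_of_map_x h.map_x_false, map_z_of_map_x h.map_x_true]
  cases i <;> simp

theorem Acts.map_uvSum {φ : L ≃ₐ[ℚ] L} {m : RootSymm} (h : d.Acts φ m) :
    φ d.uvSum = (((m.sign false * m.sign true * m.2.1 : ℤˣ) : ℤ) : L) * d.uvSum := by
  obtain ⟨i, e, s₀, s₁⟩ := m
  simp only [uvSum, map_add, map_mul, map_u_of_map_x h.map_x_false, map_u_of_map_x h.map_x_true,
    map_v_of_map_x h.map_x_false, map_v_of_map_x h.map_x_true, RootSymm.sign]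
  cases i <;> simp <;> ring

/-- A square radicand makes `vProd` rational, hence fixed, so its character is trivial. The next two
lemmas argue alike with `uvSum` and `vProd * zDiff`. -/
theorem sign_mul_eq_one (hinj : Function.Injective d.root) (hs : IsSquare (b + 2 + 2 * a))
    {φ : L ≃ₐ[ℚ] L} {m : RootSymm} (h : d.Acts φ m) : m.sign false * m.sign true = 1 := by
  have : CharZero L := algebraRat.charZero L
  obtain ⟨k, hk⟩ := hs
  apply Int.units_cast_mul_eq_self (vProd_ne hinj)
  rw [← h.map_vProd]
  have := d.vProd_sq
  rw [hk, ← pow_two, map_pow] at this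
  rcases sq_eq_sq_iff_eq_or_eq_neg.mp this with e | e <;> rw [e] <;> simp

theorem sign_mul_eq_exponent (hinj : Function.Injective d.root) (hs : IsSquare ((b - 6 + r) / 2))
    {φ : L ≃ₐ[ℚ] L} {m : RootSymm} (h : d.Acts φ m) : m.sign false * m.sign true = m.2.1 := by
  have : CharZero L := algebraRat.charZero L
  obtain ⟨k, hk⟩ := hs
  have h1 : m.sign false * m.sign true * m.2.1 = 1 := by
    apply Int.units_cast_mul_eq_self (uvSum_ne hinj)
    rw [← h.map_uvSum]
    have := d.uvSum_sq
    rw [show 2 * (b - 6 + r) = (2 * k) ^ 2 by linear_combination 4 * hk, map_pow] at this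
    rcases sq_eq_sq_iff_eq_or_eq_neg.mp this with e | e <;>
      simp only [e, map_neg, AlgEquiv.commutes]
  rw [mul_eq_one_iff_eq_inv.mp h1, Int.units_inv_eq_self]

theorem sign_mul_eq_swap (hinj : Function.Injective d.root)
    (hs : IsSquare ((a ^ 2 - 4 * b + 8) * (b + 2 + 2 * a)))
    {φ : L ≃ₐ[ℚ] L} {m : RootSymm} (h : d.Acts φ m) :
    m.sign false * m.sign true = if m.1 then -1 else 1 := by
  have : CharZero L := algebraRat.charZero L
  obtain ⟨k, hk⟩ := hs
  have h1 : m.sign false * m.sign true * (if m.1 then -1 else 1) = 1 := by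
    apply Int.units_cast_mul_eq_self (mul_ne_zero (vProd_ne hinj) (zDiff_ne hinj))
    have hm : φ (d.vProd * d.zDiff) =
        (((m.sign false * m.sign true * (if m.1 then -1 else 1) : ℤˣ) : ℤ) : L) *
          (d.vProd * d.zDiff) := by
      rw [map_mul, h.map_vProd, h.map_zDiff]; push_cast; ring
    rw [← hm]
    have : (d.vProd * d.zDiff) ^ 2 = algebraMap ℚ L k ^ 2 := by
      rw [mul_pow, d.vProd_sq, d.zDiff_sq, ← map_mul, ← map_pow]
      congr 1
      linear_combination hk
    rcases sq_eq_sq_iff_eq_or_eq_neg.mp this with e | e <;> rw [e] <;> simp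
  rw [mul_eq_one_iff_eq_inv.mp h1, Int.units_inv_eq_self]

/-! ### Symmetries realised by automorphisms. -/

/-- This is transitivity: the image of x₀ is arbitrary, while the sign at x₁ remains uncontrolled.
-/
theorem exists_acts_extending [FiniteDimensional ℚ L] [IsGalois ℚ L]
    (hirr : Irreducible (evenReciprocalOctic a b)) (hinj : Function.Injective d.root)
    (i : Bool) (e s : ℤˣ) : ∃ (φ : L ≃ₐ[ℚ] L) (s' : ℤˣ), d.Acts φ (i, e, s, s') := by
  have hmin : ∀ p, minpoly ℚ (d.root p) = evenReciprocalOctic a b := fun p =>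
    (minpoly.eq_of_irreducible_of_monic hirr (d.aeval_root p) (monic_evenReciprocalOctic a b)).symm
  obtain ⟨φ, hφ⟩ := isConjRoot_iff_exists_algEquiv.mp
    ((hmin (i, e, s)).trans (hmin (false, 1, 1)).symm : IsConjRoot ℚ _ _)
  obtain ⟨⟨j, e', t, s'⟩, hm⟩ := exists_acts hinj φ
  have := hinj ((hm _).symm.trans hφ)
  simp only [RootSymm.act, RootSymm.sign] at this
  simp at this
  obtain ⟨rfl, rfl, rfl⟩ := this
  exact ⟨φ, s', hm⟩

/-- The relation determines the sign at x₁ from the other data, so transitivity already realises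
every symmetry obeying it. -/
theorem exists_acts_of_sign_mul [FiniteDimensional ℚ L] [IsGalois ℚ L]
    (hirr : Irreducible (evenReciprocalOctic a b)) (hinj : Function.Injective d.root)
    {c : Bool → ℤˣ → ℤˣ}
    (hc : ∀ (φ : L ≃ₐ[ℚ] L) m, d.Acts φ m → m.sign false * m.sign true = c m.1 m.2.1)
    {m : RootSymm} (hm : m.sign false * m.sign true = c m.1 m.2.1) : ∃ φ, d.Acts φ m := by
  obtain ⟨i, e, s, s₁⟩ := m
  obtain ⟨φ, s', hφ⟩ := exists_acts_extending hirr hinj i e s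
  have := (hc φ _ hφ).trans hm.symm
  simp only [RootSymm.sign, if_true, Bool.false_eq_true, if_false, mul_right_inj] at this
  exact ⟨φ, this ▸ hφ⟩

/-- Without this sign change, `vProd` is fixed whenever `zDiff` and `vProd * uvSum` are. Then
`vProd` times some product of these two is rational, and each of the four possibilities contradicts
one non-square hypothesis. -/
theorem exists_acts_stabilizer [FiniteDimensional ℚ L] [IsGalois ℚ L]
    (hirr : Irreducible (evenReciprocalOctic a b)) (hinj : Function.Injective d.root)
    (hr : (b + 2) ^ 2 - 4 * a ^ 2 = r ^ 2)
    (h₁ : ¬ IsSquare (b + 2 + 2 * a)) (h₂ : ¬ IsSquare ((b - 6 + r) / 2))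
    (h₂' : ¬ IsSquare ((b - 6 - r) / 2))
    (h₃ : ¬ IsSquare ((a ^ 2 - 4 * b + 8) * (b + 2 + 2 * a))) :
    ∃ φ : L ≃ₐ[ℚ] L, d.Acts φ (false, 1, 1, -1) := by
  have : CharZero L := algebraRat.charZero L
  have hinjQ := (algebraMap ℚ L).injective
  by_contra hno
  -- Conjugation by an automorphism swapping the quartics exchanges the sign changes at x₀ and x₁.
  have hno' : ∀ φ : L ≃ₐ[ℚ] L, ¬ d.Acts φ (false, 1, -1, 1) := by
    intro g hg
    obtain ⟨τ, s', hτ⟩ := exists_acts_extending hirr hinj true 1 1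
    refine hno ⟨(τ.trans g).trans τ.symm, fun p => ?_⟩
    have : g (τ (d.root p)) = τ (d.root (RootSymm.act (false, 1, 1, -1) p)) := by
      rw [hτ, hg, hτ]
      obtain ⟨i, e, s⟩ := p
      cases i <;> simp [RootSymm.act, RootSymm.sign]
    simp [this]
  obtain ⟨σ, sσ, hσ⟩ := exists_acts_extending hirr hinj false (-1) 1
  obtain ⟨τ, sτ, hτ⟩ := exists_acts_extending hirr hinj true 1 1
  have hsgn : ∀ (s : ℤˣ) (y : L), ((s : ℤ) : L) * y = y ∨ ((s : ℤ) : L) * y = -y := by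
    intro s y
    rcases Int.units_eq_one_or s with rfl | rfl <;> simp
  -- The factor s₀s₁ cancels, so `vProd * uvSum` detects the exponent alone.
  have hE : ∀ {φ : L ≃ₐ[ℚ] L} {m}, d.Acts φ m →
      φ (d.vProd * d.uvSum) = ((m.2.1 : ℤ) : L) * (d.vProd * d.uvSum) := by
    intro φ m h
    have hq : (((m.sign false * m.sign true : ℤˣ) : ℤ) : L) *
        (((m.sign false * m.sign true : ℤˣ) : ℤ) : L) = 1 := by
      rw [← Int.cast_mul, ← Units.val_mul, Int.units_mul_self]; simp
    rw [map_mul, h.map_vProd, h.map_uvSum, Units.val_mul _ m.2.1, Int.cast_mul]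
    linear_combination ((m.2.1 : ℤ) : L) * d.vProd * d.uvSum * hq
  have hEne := mul_ne_zero (vProd_ne hinj) (uvSum_ne hinj)
  rcases fixed_of_sign_dependent (Z := d.zDiff) (E := d.vProd * d.uvSum) (Q := d.vProd)
    (fun g => by obtain ⟨m, h⟩ := exists_acts hinj g; rw [h.map_zDiff]; exact hsgn _ _)
    (fun g => by obtain ⟨m, h⟩ := exists_acts hinj g; rw [hE h]; exact hsgn _ _)
    (fun g => by obtain ⟨m, h⟩ := exists_acts hinj g; rw [h.map_vProd]; exact hsgn _ _)
    (σ := σ) (τ := τ) (by rw [hσ.map_zDiff]; simp) (by rw [hE hσ]; simp)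
    (by rw [hτ.map_zDiff]; simp) (by rw [hE hτ]; simp) (by
      intro g gZ gE
      obtain ⟨⟨i, e, s₀, s₁⟩, h⟩ := exists_acts hinj g
      rw [h.map_zDiff] at gZ
      rw [hE h] at gE
      have hi := Int.units_cast_mul_eq_self (zDiff_ne hinj) gZ
      obtain rfl : e = 1 := Int.units_cast_mul_eq_self hEne gE
      obtain rfl : i = false := by
        cases i
        · rfl
        · exact absurd (show (-1 : ℤˣ) = 1 from hi) (by decide)
      rw [h.map_vProd]
      rcases Int.units_eq_one_or s₀ with rfl | rfl <;> rcases Int.units_eq_one_or s₁ with rfl | rfl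
      · simp [RootSymm.sign]
      · exact absurd ⟨g, h⟩ hno
      · exact absurd h (hno' g)
      · simp [RootSymm.sign]) with h | h | h | h <;>
    obtain ⟨q, hq⟩ := exists_algebraMap_eq_of_fixed h
  · refine h₁ ⟨q, hinjQ ?_⟩
    rw [map_mul, hq, ← d.vProd_sq, pow_two]
  · refine h₃ ⟨q, hinjQ ?_⟩
    rw [map_mul, map_mul, hq, ← d.vProd_sq, ← d.zDiff_sq]; ring
  · have hs : b + 2 + 2 * a ≠ 0 := fun h => h₁ (h ▸ IsSquare.zero)
    have hq' : q ^ 2 = (b + 2 + 2 * a) ^ 2 * (2 * (b - 6 + r)) := by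
      apply hinjQ
      rw [map_pow, map_mul, map_pow, hq, ← d.vProd_sq, ← d.uvSum_sq]; ring
    -- Here q = `vProd`² · `uvSum`, with `vProd`² = b+2+2a.
    refine h₂ ⟨q / (2 * (b + 2 + 2 * a)), ?_⟩
    field_simp
    linear_combination -hq'
  · have hs : b + 2 + 2 * a ≠ 0 := fun h => h₁ (h ▸ IsSquare.zero)
    have hn : b - 6 + r ≠ 0 := fun h => h₂ (by rw [h, zero_div]; exact IsSquare.zero)
    have hq' : q ^ 2 = (b + 2 + 2 * a) ^ 2 * (a ^ 2 - 4 * b + 8) * (2 * (b - 6 + r)) := by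
      apply hinjQ
      rw [map_pow, map_mul, map_mul, map_pow, hq, ← d.vProd_sq, ← d.uvSum_sq, ← d.zDiff_sq]; ring
    -- Since (b-6+r)(b-6-r) = 4(a²-4b+8), the rationality of `zDiff * uvSum` concerns the conjugate
    -- number (b-6-r)/2.
    refine h₂' ⟨q / ((b + 2 + 2 * a) * (b - 6 + r)), ?_⟩
    have hD : (b - 6 + r) * (b - 6 - r) = 4 * (a ^ 2 - 4 * b + 8) := by linear_combination hr
    field_simp
    linear_combination -2 * hq' + (b + 2 + 2 * a) ^ 2 * (b - 6 + r) * hD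

/-- Precomposing with the sign change at x₁ corrects the one sign that transitivity leaves open. -/
theorem exists_acts_of_stabilizer [FiniteDimensional ℚ L] [IsGalois ℚ L]
    (hirr : Irreducible (evenReciprocalOctic a b)) (hinj : Function.Injective d.root)
    (ht : ∃ φ : L ≃ₐ[ℚ] L, d.Acts φ (false, 1, 1, -1)) (m : RootSymm) : ∃ φ, d.Acts φ m := by
  obtain ⟨i, e, s, s₁⟩ := m
  obtain ⟨φ, s', hφ⟩ := exists_acts_extending hirr hinj i e s
  obtain ⟨t, ht⟩ := ht
  rcases eq_or_ne s' s₁ with rfl | hne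
  · exact ⟨φ, hφ⟩
  · obtain rfl : s₁ = -s' := by
      rcases Int.units_eq_one_or s' with rfl | rfl <;>
        rcases Int.units_eq_one_or s₁ with rfl | rfl <;> simp_all
    refine ⟨t.trans φ, fun p => ?_⟩
    rw [AlgEquiv.trans_apply, ht, hφ]
    obtain ⟨j, e', s''⟩ := p
    cases j <;> simp [RootSymm.act, RootSymm.sign]

/-- Recognition of the Galois type from the set `P` of symmetries realised by automorphisms. -/
theorem hasGaloisType {n : ℕ} {a b r : ℚ}
    {d : BaseRoots a b r (evenReciprocalOctic a b).SplittingField}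
    (hinj : Function.Injective d.root) {P : RootSymm → Prop}
    (hP : ∀ φ m, d.Acts φ m → P m) (hP' : ∀ m, P m → ∃ φ, d.Acts φ m)
    {S : Set (Equiv.Perm (Fin n))} {l : Fin n → RootIndex} (hl : Function.Bijective l)
    (hS : ∀ m, P m → ∃ π ∈ Subgroup.closure S, ∀ j, m.act (l j) = l (π j))
    (hS' : ∀ π ∈ S, ∃ m, P m ∧ ∀ j, m.act (l j) = l (π j)) :
    HasGaloisType (evenReciprocalOctic a b) (Subgroup.closure S) := by
  refine hasGaloisType_closure S (d.root ∘ l) (hinj.comp hl.injective) ?_ ?_ ?_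
  · rw [hl.surjective.range_comp, d.range_root]
  · intro φ
    obtain ⟨m, hm⟩ := exists_acts hinj φ
    obtain ⟨π, hπ, h⟩ := hS m (hP φ m hm)
    exact ⟨π, hπ, fun j => by rw [Function.comp_apply, hm, h]; rfl⟩
  · intro π hπ
    obtain ⟨m, hm, h⟩ := hS' π hπ
    obtain ⟨φ, hφ⟩ := hP' m hm
    exact ⟨φ, fun j => by rw [Function.comp_apply, hφ, h]; rfl⟩

end BaseRoots

/-! ### The four cases. -/

open BaseRoots in
theorem theorem4p5 (a b r : ℚ) (f : ℚ[X])
    (hf : f = X ^ 8 + C a * X ^ 6 + C b * X ^ 4 + C a * X ^ 2 + 1)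
    (ha : a ≠ 0) (hirr : Irreducible f) (hr : (b + 2) ^ 2 - 4 * a ^ 2 = r ^ 2) :
    (IsSquare (b + 2 + 2 * a) → HasGaloisType f T8_3) ∧
    (¬ IsSquare (b + 2 + 2 * a) →
      (IsSquare ((b - 6 + r) / 2) ∨ IsSquare ((b - 6 - r) / 2)) → HasGaloisType f T8_4) ∧
    (¬ IsSquare (b + 2 + 2 * a) →
      ¬ (IsSquare ((b - 6 + r) / 2) ∨ IsSquare ((b - 6 - r) / 2)) →
      IsSquare ((a ^ 2 - 4 * b + 8) * (b + 2 + 2 * a)) → HasGaloisType f T8_2) ∧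
    (¬ IsSquare (b + 2 + 2 * a) →
      ¬ (IsSquare ((b - 6 + r) / 2) ∨ IsSquare ((b - 6 - r) / 2)) →
      ¬ IsSquare ((a ^ 2 - 4 * b + 8) * (b + 2 + 2 * a)) → HasGaloisType f T8_9) := by
  obtain rfl : f = evenReciprocalOctic a b := hf
  have := isGalois_splittingField_rat hirr.separable
  have hs := SplittingField.splits (evenReciprocalOctic a b)
  have hd : ∀ {r}, (b + 2) ^ 2 - 4 * a ^ 2 = r ^ 2 →
      ∃ d : BaseRoots a b r (evenReciprocalOctic a b).SplittingField,
        Function.Injective d.root := fun hr =>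
    let ⟨d⟩ := exists_baseRoots hs hr
    ⟨d, d.root_injective hirr hs⟩
  -- A variable r covers both alternatives: the second is the first for -r, with base roots chosen
  -- to match.
  have dihedral : ∀ {r}, (b + 2) ^ 2 - 4 * a ^ 2 = r ^ 2 → IsSquare ((b - 6 + r) / 2) →
      HasGaloisType (evenReciprocalOctic a b) T8_4 := by
    intro r hr h
    obtain ⟨d, hinj⟩ := hd hr
    refine hasGaloisType (d := d) hinj (fun _ _ => sign_mul_eq_exponent hinj h)
      (fun _ => exists_acts_of_sign_mul (c := fun _ e => e) hirr hinj
        fun _ _ => sign_mul_eq_exponent hinj h)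
      regularLabel_bijective exists_mem_T8_4 ?_
    -- Letter 0 is x₀, so its image under the generator gives w, e and s₀; the relation s₀s₁ = e
    -- then gives s₁.
    rintro π (rfl | rfl)
    · exact ⟨(true, -1, 1, -1), by decide, by decide +kernel⟩
    · exact ⟨(true, 1, -1, -1), by decide, by decide +kernel⟩
  obtain ⟨d, hinj⟩ := hd hr
  refine ⟨fun h => ?_, fun _ h => ?_, fun _ _ h => ?_, fun h₁ h₂ h₃ => ?_⟩
  · refine hasGaloisType (d := d) hinj (fun _ _ => sign_mul_eq_one hinj h)
      (fun _ => exists_acts_of_sign_mul (c := fun _ _ => 1) hirr hinj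
        fun _ _ => sign_mul_eq_one hinj h)
      regularLabel_bijective exists_mem_T8_3 ?_
    rintro π (rfl | rfl | rfl)
    · exact ⟨(true, -1, -1, -1), by decide, by decide +kernel⟩
    · exact ⟨(false, 1, -1, -1), by decide, by decide +kernel⟩
    · exact ⟨(false, -1, -1, -1), by decide, by decide +kernel⟩
  · rcases h with h | h
    · exact dihedral hr h
    · exact dihedral (r := -r) (by rw [neg_sq, hr]) (by rwa [← sub_eq_add_neg])
  · refine hasGaloisType (d := d) hinj (fun _ _ => sign_mul_eq_swap hinj h)
      (fun _ => exists_acts_of_sign_mul (c := fun i _ => if i then -1 else 1) hirr hinj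
        fun _ _ => sign_mul_eq_swap hinj h)
      regularLabel_bijective exists_mem_T8_2 ?_
    rintro π (rfl | rfl)
    · exact ⟨(true, -1, 1, -1), by decide, by decide +kernel⟩
    · exact ⟨(false, -1, -1, -1), by decide, by decide +kernel⟩
  · rw [not_or] at h₂
    refine hasGaloisType (d := d) hinj (P := fun _ => True) (fun _ _ _ => trivial)
      (fun m _ => exists_acts_of_stabilizer hirr hinj
        (exists_acts_stabilizer hirr hinj hr h₁ h₂.1 h₂.2 h₃) m)
      genericLabel_bijective (fun m _ => exists_mem_T8_9 m) ?_
    rintro π (rfl | rfl | rfl | rfl)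
    · exact ⟨(false, 1, -1, -1), trivial, by decide +kernel⟩
    · exact ⟨(false, -1, -1, -1), trivial, by decide +kernel⟩
    · exact ⟨(true, 1, -1, -1), trivial, by decide +kernel⟩
    · exact ⟨(false, 1, 1, -1), trivial, by decide +kernel⟩
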